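/- Fields are not assumed commutative unless this is said. An element $x$ of a field extension $h/k$ is algebraic over $k$ if the subfield $k(x)\subset h$ generated by $k$ and $x$ has finite dimension both as a left and as a right vector space over $k$; the extension $h/k$ is regular if every element of $h$ algebraic over $k$ lies in $k$. It is outer if the only inner automorphism of $h$ which is the identity on $k$ is the identity of $h$, and it is Galois if $k$ is the field of elements of $h$ fixed by the group $\mathrm{Gal}(h/k)$ of all automorphisms of $h$ that are the identity on $k$. For a field extension $K/k$, the property $\mathrm{RIGP}_{K/k}$ says that for every finite group $G$ there is an outer Galois extension $L/K$, with $L$ regular over $k$, such that $\mathrm{Gal}(L/K)\simeq G$. The class $\mathrm{InvReg}(k)$ consists of the regular extensions $K/k$ for which $\mathrm{RIGP}_{K/k}$ holds. For a commutative field $k$, the property $\mathrm{RIGP}_k$ says that for every finite group $G$ there is a Galois extension $L/k(t)$ of commutative fields, with $k$ algebraically closed in $L$, such that $\mathrm{Gal}(L/k(t))\simeq G$. Proposition 3. Let $k$ be a commutative field. (i) $\mathrm{RIGP}_{k(t)/k}$ is equivalent to $\mathrm{RIGP}_k$. Moreover, every outer Galois extension of $k(t)$ with finite Galois group is commutative.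 (ii) If $\mathrm{RIGP}_k$ holds, then every commutative regular extension $E/k$ with $E\neq k$ which has finite degree over some subextension $K/k$ that is purely transcendental over $k$ (of arbitrary transcendence degree), and which is monogenic over $K$ (that is, $E=K(\alpha)$ for some $\alpha\in E$), belongs to $\mathrm{InvReg}(k)$. -/

import Mathlib

universe u v w

/-! Fields are not assumed commutative: a field is a `DivisionRing`, a commutative field a `Field`.
An extension `h/k` is given by its embedding, a ring homomorphism `f : k →+* h`. -/

namespace SkewExt

section

variable {k : Type u} {h : Type v} [DivisionRing k] [DivisionRing h]

/-- `h` has finite dimension as a left vector space over `k`, for `c • x = f c * x`. -/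
def LeftFinite (f : k →+* h) : Prop :=
  @Module.Finite k h _ _ f.toModule

/-- `h` has finite dimension as a right vector space over `k`, for `x • c = x * f c`. -/
def RightFinite (f : k →+* h) : Prop :=
  @Module.Finite kᵐᵒᵖ h _ _ (Module.compHom h f.op)

/-- The subfield `k(x)` of `h` generated by `k` and `x`. -/
def adjoinElem (f : k →+* h) (x : h) : Subfield h :=
  Subfield.closure (Set.range f ∪ {x})

theorem map_mem_adjoinElem (f : k →+* h) (x : h) (c : k) : f c ∈ adjoinElem f x :=
  Subfield.subset_closure (Or.inl ⟨c, rfl⟩)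

/-- The embedding of `k` into `k(x)`. -/
def toAdjoinElem (f : k →+* h) (x : h) : k →+* adjoinElem f x :=
  f.codRestrict (adjoinElem f x) (map_mem_adjoinElem f x)

/-- `x` is algebraic over `k`: the field `k(x)` has finite dimension both as a left and as a right
vector space over `k`. -/
def IsAlgebraicElem (f : k →+* h) (x : h) : Prop :=
  LeftFinite (toAdjoinElem f x) ∧ RightFinite (toAdjoinElem f x)

/-- `h/k` is regular: every element of `h` that is algebraic over `k` belongs to `k`. -/
def IsRegularExt (f : k →+* h) : Prop :=
  ∀ x : h, IsAlgebraicElem f x → x ∈ Set.range f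

/-- `h/k` is outer: the only inner automorphism of `h` that restricts to the identity on `k`
is the identity of `h`. -/
def IsOuterExt (f : k →+* h) : Prop :=
  ∀ a : hˣ, (∀ c : k, (a : h) * f c * ((a⁻¹ : hˣ) : h) = f c) →
    ∀ x : h, (a : h) * x * ((a⁻¹ : hˣ) : h) = x

/-- `Gal(h/k)`: the group of the automorphisms of the field `h` that fix `k` pointwise. -/
def Gal (f : k →+* h) : Subgroup (RingAut h) :=
  fixingSubgroup (RingAut h) (Set.range f)

/-- `h/k` is Galois: the elements of `h` fixed by `Gal(h/k)` are those of `k`. -/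
def IsGaloisExt (f : k →+* h) : Prop :=
  ∀ x : h, (∀ σ ∈ Gal f, σ x = x) → x ∈ Set.range f

end

section

variable {k : Type u} {K : Type v} [DivisionRing k] [DivisionRing K]

/-- The regular inverse Galois property for `K/k`: every finite group is the Galois group of an
outer Galois extension `L/K` such that `L/k` is regular. -/
def RIGPExt (f : k →+* K) : Prop :=
  ∀ (G : Type) [Group G] [Finite G],
    ∃ (L : Type v) (_ : DivisionRing L) (g : K →+* L),
      IsOuterExt g ∧ IsGaloisExt g ∧ IsRegularExt (g.comp f) ∧ Nonempty (Gal g ≃* G)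

/-- `K/k` belongs to the class `InvReg(k)`. -/
def InvReg (f : k →+* K) : Prop :=
  IsRegularExt f ∧ RIGPExt f

end

/-- The classical regular inverse Galois property of a commutative field `k`: every finite group is
the Galois group of a Galois extension `L/k(t)` of commutative fields such that `k` is algebraically
closed in `L`. -/
def ClassicalRIGP (k : Type u) [Field k] : Prop :=
  ∀ (G : Type) [Group G] [Finite G],
    ∃ (L : Type u) (_ : Field L) (_ : Algebra k L) (_ : Algebra (RatFunc k) L)
      (_ : IsScalarTower k (RatFunc k) L),
      IsGalois (RatFunc k) L ∧ algebraicClosure k L = ⊥ ∧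
        Nonempty ((L ≃ₐ[RatFunc k] L) ≃* G)

/-- The intermediate field `K` of `E/k` is purely transcendental over `k`: it is generated over `k`
by a (possibly infinite) algebraically independent set. -/
def IsPurelyTranscendental {k : Type u} {E : Type v} [Field k] [Field E] [Algebra k E]
    (K : IntermediateField k E) : Prop :=
  ∃ S : Set E, AlgebraicIndependent k ((↑) : S → E) ∧ IntermediateField.adjoin k S = K

end SkewExt

/-! ### Degrees, algebraic closedness and a counting argument in powers of a finite group. -/

section

open Polynomial IntermediateField

/-! For (i), in an outer extension of a commutative field the scalars are central, and then so is
every element (`IsOuterExt.mul_comm`); on commutative fields the skew notions are the classical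
ones.

For (ii), choose t in a transcendence basis S with K = k(S), and put R = k(t), B = R(S \ {t}), which
is K. Realise not G but G^n over R by a field L, with 2^n > [E : B], and embed L in a Galois
extension M of E. Let U be the subgroup of Gal(M/E) fixing all elements of M algebraic over k, and H
its image in Gal(L/R) = G^n. A degree comparison gives [L^H : R] ≤ [E : B] < 2^n, so H is too large
to have only proper coordinate projections. For a coordinate where H surjects onto G, the map ψ from
Gal(M/E) to G is already onto on U, and the fixed field of its kernel has group G over E and
acquires no new constants. The work is in `natDegree_minpoly_le_finrank_of_mem_adjoin_simple` and
`exists_isGalois_of_finrank_lt`. -/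

/-- The coefficients of a monic factor over `B` of a monic polynomial over `A` are integral over
`A`, hence already in `A`. -/
theorem minpoly_eq_map_of_isAlgebraic_mem_range {A B Ω : Type*} [Field A] [Field B] [Field Ω]
    [Algebra A B] [Algebra B Ω] [Algebra A Ω] [IsScalarTower A B Ω]
    (h : ∀ x : B, IsAlgebraic A x → x ∈ Set.range (algebraMap A B)) {x : Ω}
    (hx : IsIntegral A x) : minpoly B x = (minpoly A x).map (algebraMap A B) := by
  have hB : IsIntegral B x := hx.tower_top
  have hcoeff : ∀ n, (minpoly B x).coeff n ∈ (algebraMap A B).range := fun n =>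
    h _ (isIntegral_coeff_of_dvd (minpoly A x) (minpoly B x) (minpoly.monic hx)
      (minpoly.monic hB) (minpoly.dvd_map_of_isScalarTower A B x) n).isAlgebraic
  obtain ⟨q, hq⟩ := (mem_map_range (algebraMap A B)).2 hcoeff
  have hqx : aeval x q = 0 := by
    rw [← aeval_map_algebraMap B, ← coe_mapRingHom, hq, minpoly.aeval]
  have hdvd : (minpoly A x).map (algebraMap A B) ∣ minpoly B x := by
    rw [← hq, coe_mapRingHom]
    exact Polynomial.map_dvd _ (minpoly.dvd A x hqx)
  exact eq_of_monic_of_associated (minpoly.monic hB) ((minpoly.monic hx).map _)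
    (associated_of_dvd_dvd (minpoly.dvd_map_of_isScalarTower A B x) hdvd)

theorem MvPolynomial.mem_range_C_of_isIntegral {ι F : Type*} [Field F] {p : MvPolynomial ι F}
    (hp : IsIntegral F p) : p ∈ Set.range (MvPolynomial.C : F → MvPolynomial ι F) := by
  by_cases h0 : p = 0
  · exact ⟨0, by simp [h0]⟩
  · have : IsUnit p := hp.isUnit h0
    obtain ⟨r, -, hr⟩ := MvPolynomial.isUnit_iff_eq_C_of_isReduced.1 this
    exact ⟨r, hr.symm⟩

/-- A polynomial ring over a field is integrally closed, so an algebraic rational function is a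
polynomial; if nonzero it is a unit, hence constant. -/
theorem AlgebraicIndependent.mem_range_of_mem_adjoin_of_isAlgebraic {ι F Ω : Type*} [Field F]
    [Field Ω] [Algebra F Ω] {s : ι → Ω} (hs : AlgebraicIndependent F s) {x : Ω}
    (hx : x ∈ adjoin F (Set.range s)) (ha : IsAlgebraic F x) :
    x ∈ Set.range (algebraMap F Ω) := by
  obtain ⟨y, hy⟩ := hs.aevalEquivField.surjective ⟨x, hx⟩
  have hyx : ((hs.aevalEquivField y : adjoin F (Set.range s)) : Ω) = x := by rw [hy]
  have hyint : IsIntegral F y := by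
    let f : FractionRing (MvPolynomial ι F) →ₐ[F] Ω :=
      (adjoin F (Set.range s)).val.comp hs.aevalEquivField.toAlgHom
    have : IsIntegral F (f y) := by
      change IsIntegral F ((hs.aevalEquivField y : adjoin F (Set.range s)) : Ω)
      rw [hyx]; exact ha.isIntegral
    exact (isIntegral_algHom_iff f f.toRingHom.injective).1 this
  obtain ⟨p, rfl⟩ := IsIntegrallyClosed.isIntegral_iff.1
    (hyint.tower_top (A := MvPolynomial ι F))
  have hp : IsIntegral F p := (isIntegral_algebraMap_iff (IsFractionRing.injective _ _)).1 hyint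
  obtain ⟨r, rfl⟩ := MvPolynomial.mem_range_C_of_isIntegral hp
  refine ⟨r, ?_⟩
  rw [← hyx]
  simp

/-- If every projection of `H` were proper, each would have index at least 2, and `H`, lying in
their product, would have index at least 2^n. -/
theorem Subgroup.exists_surjective_eval_of_card_le {G : Type*} [Group G] [Finite G] {n d : ℕ}
    (H : Subgroup (Fin n → G)) (hd : d < 2 ^ n) (hH : Nat.card (Fin n → G) ≤ Nat.card H * d) :
    ∃ i, ∀ g : G, ∃ x ∈ H, x i = g := by
  by_contra! hcon
  let P : Fin n → Subgroup G := fun i => H.map (Pi.evalMonoidHom (fun _ => G) i)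
  have hP : ∀ i, Nat.card (P i) * 2 ≤ Nat.card G := by
    intro i
    have htop : P i ≠ ⊤ := by
      intro htop
      obtain ⟨g, hg⟩ := hcon i
      obtain ⟨x, hx, rfl⟩ : g ∈ P i := htop ▸ Subgroup.mem_top g
      exact hg x hx rfl
    rw [← (P i).card_mul_index]
    refine Nat.mul_le_mul_left _ ?_
    have h1 : (P i).index ≠ 1 := fun h => htop (Subgroup.index_eq_one.1 h)
    have h0 : (P i).index ≠ 0 := Subgroup.index_ne_zero_of_finite
    omega
  have hcard : Nat.card H ≤ ∏ i, Nat.card (P i) := by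
    rw [← Nat.card_pi]
    refine Nat.card_le_card_of_injective
      (fun x : H => fun i => (⟨x.1 i, ⟨x.1, x.2, rfl⟩⟩ : P i)) ?_
    intro x y hxy
    ext i
    exact congrArg Subtype.val (congrFun hxy i)
  have h2 : Nat.card H * 2 ^ n ≤ Nat.card (Fin n → G) := by
    calc Nat.card H * 2 ^ n ≤ (∏ i, Nat.card (P i)) * ∏ _i : Fin n, 2 := by
          rw [Finset.prod_const, Finset.card_univ, Fintype.card_fin]
          exact Nat.mul_le_mul_right _ hcard
      _ = ∏ i, (Nat.card (P i) * 2) := Finset.prod_mul_distrib.symm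
      _ ≤ ∏ _i : Fin n, Nat.card G := Finset.prod_le_prod' fun i _ => hP i
      _ = Nat.card (Fin n → G) := by simp [Nat.card_pi]
  have hpos : 0 < Nat.card H := Nat.card_pos
  have := Nat.mul_lt_mul_of_pos_left hd hpos
  omega

/-- Since B(θ, c) lies in E(c), [B(θ) : B] · [B(θ, c) : B(θ)] ≤ [E : B] · [E(c) : E]. The factors
involving `c` both equal [k(c) : k] and cancel, while [B(θ) : B] = [R(θ) : R]. -/
theorem natDegree_minpoly_le_finrank_of_mem_adjoin_simple {k R B E L M : Type*}
    [Field k] [Field R] [Field B] [Field E] [Field L] [Field M]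
    [Algebra k R] [Algebra R B] [Algebra k E] [Algebra B E] [Algebra R L]
    [Algebra k B] [Algebra k M] [Algebra R M] [Algebra B M] [Algebra E M] [Algebra L M]
    [IsScalarTower k B M] [IsScalarTower R B M] [IsScalarTower k E M] [IsScalarTower B E M]
    [IsScalarTower R L M] [FiniteDimensional B E]
    (hRB : ∀ x : B, IsAlgebraic R x → x ∈ Set.range (algebraMap R B))
    (hkL : ∀ x ∈ adjoin L (Set.range (algebraMap B M)), IsAlgebraic k x →
      x ∈ Set.range (algebraMap k M))
    (hkE : ∀ x : E, IsAlgebraic k x → x ∈ Set.range (algebraMap k E))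
    {θ : L} (hθ : IsIntegral R θ) {c : M} (hc : IsIntegral k c)
    (hθc : algebraMap L M θ ∈ adjoin E {c}) :
    (minpoly R θ).natDegree ≤ Module.finrank B E := by
  set θ' := algebraMap L M θ with hθ'
  have hθi : IsIntegral R θ' := hθ.map (IsScalarTower.toAlgHom R L M)
  have hθB : IsIntegral B θ' := hθi.tower_top
  let C : IntermediateField B M := adjoin B {θ'}
  let D : IntermediateField C M := adjoin C {c}
  let N : IntermediateField E M := adjoin E {c}
  have : IsScalarTower k C M := IsScalarTower.of_algebraMap_eq fun _ => rfl
  have hcC : IsIntegral C c := hc.tower_top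
  have hcE : IsIntegral E c := hc.tower_top
  -- B(θ) is contained in the compositum of L and B, where `hkL` applies.
  have hkC : ∀ x : C, IsAlgebraic k x → x ∈ Set.range (algebraMap k C) := by
    intro x hx
    have hmem : (x : M) ∈ adjoin L (Set.range (algebraMap B M)) := by
      have : C ≤ (adjoin L (Set.range (algebraMap B M))).toSubfield.toIntermediateField
          (fun b => subset_adjoin L _ ⟨b, rfl⟩) := by
        rw [adjoin_le_iff, Set.singleton_subset_iff]
        exact (adjoin L (Set.range (algebraMap B M))).algebraMap_mem θ
      exact this x.2
    obtain ⟨a, ha⟩ := hkL x hmem (hx.algebraMap (A := M))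
    exact ⟨a, Subtype.ext (by rw [← ha]; exact (IsScalarTower.algebraMap_apply k C M a).symm)⟩
  have h1 : Module.finrank B C = (minpoly R θ).natDegree := by
    rw [adjoin.finrank hθB, minpoly_eq_map_of_isAlgebraic_mem_range hRB hθi, natDegree_map,
      minpoly.algebraMap_eq (algebraMap L M).injective]
  have h2 : Module.finrank C D = (minpoly k c).natDegree := by
    rw [adjoin.finrank hcC, minpoly_eq_map_of_isAlgebraic_mem_range hkC hc, natDegree_map]
  have h3 : Module.finrank E N = (minpoly k c).natDegree := by
    rw [adjoin.finrank hcE, minpoly_eq_map_of_isAlgebraic_mem_range hkE hc, natDegree_map]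
  have : FiniteDimensional E N := adjoin.finiteDimensional hcE
  have : FiniteDimensional B N := Module.Finite.trans E N
  have hCN : C ≤ N.restrictScalars B := by
    rw [adjoin_le_iff, Set.singleton_subset_iff]
    exact hθc
  have hDN : D.restrictScalars B ≤ N.restrictScalars B := by
    have : D ≤ N.toSubfield.toIntermediateField (fun x => hCN x.2) := by
      rw [adjoin_le_iff, Set.singleton_subset_iff]
      exact mem_adjoin_simple_self E c
    exact this
  have h4 : Module.finrank B D ≤ Module.finrank B N := by
    have : Module.Finite B (N.restrictScalars B).toSubalgebra.toSubmodule :=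
      inferInstanceAs (Module.Finite B N)
    exact Submodule.finrank_mono (R := B) (M := M)
      (s := (D.restrictScalars B).toSubalgebra.toSubmodule)
      (t := (N.restrictScalars B).toSubalgebra.toSubmodule) hDN
  rw [← Module.finrank_mul_finrank B C D, ← Module.finrank_mul_finrank B E N, h1, h2, h3] at h4
  exact Nat.le_of_mul_le_mul_right h4 (minpoly.natDegree_pos hc)

theorem IsGalois.exists_isGalois_algHom {R : Type u} {E : Type v} (L : Type w) [Field R] [Field E]
    [Field L] [Algebra R E] [Algebra R L] [FiniteDimensional R L] [IsGalois R L] :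
    ∃ (M : Type v) (_ : Field M) (_ : Algebra E M) (_ : Algebra R M) (_ : IsScalarTower R E M),
      FiniteDimensional E M ∧ IsGalois E M ∧ Nonempty (L →ₐ[R] M) := by
  obtain ⟨p, hp, hpL⟩ := IsGalois.is_separable_splitting_field R L
  let q := p.map (algebraMap R E)
  refine ⟨q.SplittingField, inferInstance, inferInstance, inferInstance, inferInstance,
    inferInstance, IsGalois.of_separable_splitting_field (p := q) hp.map, ⟨?_⟩⟩
  refine IsSplittingField.lift L p ?_
  have := SplittingField.splits q
  rwa [Polynomial.map_map, ← IsScalarTower.algebraMap_eq] at this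

/-- Minimal polynomials over `k` and `E` agree, so separability descends to `k` and the primitive
element theorem merges finitely many constants into one. -/
theorem mem_adjoin_simple_of_mem_adjoin_isAlgebraic {k E M : Type*} [Field k] [Field E] [Field M]
    [Algebra k E] [Algebra E M] [Algebra k M] [IsScalarTower k E M] [Algebra.IsSeparable E M]
    (hkE : ∀ x : E, IsAlgebraic k x → x ∈ Set.range (algebraMap k E)) {x : M}
    (hx : x ∈ adjoin E {c : M | IsAlgebraic k c}) :
    ∃ c : M, IsAlgebraic k c ∧ x ∈ adjoin E {c} := by
  obtain ⟨T, hT, hxT⟩ := exists_finset_of_mem_adjoin hx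
  have hsep : ∀ c ∈ T, IsSeparable k c := by
    intro c hc
    have h := Algebra.IsSeparable.isSeparable E c
    rw [IsSeparable, minpoly_eq_map_of_isAlgebraic_mem_range hkE (hT hc).isIntegral,
      separable_map] at h
    exact h
  have hfin : FiniteDimensional k (adjoin k (T : Set M)) :=
    finiteDimensional_adjoin fun c hc => (hT hc).isIntegral
  have : Algebra.IsSeparable k (adjoin k (T : Set M)) :=
    (isSeparable_adjoin_iff_isSeparable _ _).2 hsep
  obtain ⟨c, hc⟩ := Field.exists_primitive_element k (adjoin k (T : Set M))
  refine ⟨c, ((Algebra.IsAlgebraic.isAlgebraic (R := k) c).algebraMap (A := M)), ?_⟩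
  have hle : adjoin k (T : Set M) = adjoin k {(c : M)} := by
    have := congrArg (IntermediateField.map (adjoin k (T : Set M)).val) hc
    rw [adjoin_map, Set.image_singleton, ← AlgHom.fieldRange_eq_map, fieldRange_val] at this
    exact this.symm
  have hTc : adjoin E (T : Set M) ≤ adjoin E {(c : M)} := by
    rw [adjoin_le_iff]
    intro y hy
    have hy' : y ∈ adjoin k {(c : M)} := hle ▸ subset_adjoin k _ hy
    have : adjoin k {(c : M)} ≤ (adjoin E {(c : M)}).restrictScalars k := by
      rw [adjoin_le_iff, Set.singleton_subset_iff]
      exact mem_adjoin_simple_self E _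
    exact this hy'
  exact hTc hxT

/-! ### Realising G over E. -/

theorem exists_isGalois_of_finrank_lt {k R B E L M : Type*}
    [Field k] [Field R] [Field B] [Field E] [Field L] [Field M]
    [Algebra k R] [Algebra R B] [Algebra R E] [Algebra k E] [Algebra B E] [Algebra R L]
    [Algebra k B] [Algebra k M] [Algebra R M] [Algebra B M] [Algebra E M] [Algebra L M]
    [IsScalarTower k B M] [IsScalarTower R B M] [IsScalarTower k E M] [IsScalarTower B E M]
    [IsScalarTower R E M] [IsScalarTower R L M] [FiniteDimensional B E]
    [FiniteDimensional R L] [IsGalois R L] [FiniteDimensional E M] [IsGalois E M]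
    (hRB : ∀ x : B, IsAlgebraic R x → x ∈ Set.range (algebraMap R B))
    (hkL : ∀ x ∈ adjoin L (Set.range (algebraMap B M)), IsAlgebraic k x →
      x ∈ Set.range (algebraMap k M))
    (hkE : ∀ x : E, IsAlgebraic k x → x ∈ Set.range (algebraMap k E))
    {G : Type*} [Group G] [Finite G] {n : ℕ} (hn : Module.finrank B E < 2 ^ n)
    (e : (L ≃ₐ[R] L) ≃* (Fin n → G)) :
    ∃ F : IntermediateField E M, IsGalois E F ∧ FiniteDimensional E F ∧
      (∀ x ∈ F, IsAlgebraic k x → x ∈ Set.range (algebraMap k M)) ∧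
      Nonempty ((F ≃ₐ[E] F) ≃* G) := by
  let ρ : (M ≃ₐ[E] M) →* (L ≃ₐ[R] L) :=
    (AlgEquiv.restrictNormalHom L).comp (AlgEquiv.restrictScalarsHom R)
  have hρ : ∀ (σ : M ≃ₐ[E] M) (x : L), algebraMap L M (ρ σ x) = σ (algebraMap L M x) :=
    fun σ x => AlgEquiv.restrictNormal_commutes (σ.restrictScalars R) L x
  let N : IntermediateField E M := adjoin E {c : M | IsAlgebraic k c}
  let U := N.fixingSubgroup
  let H := U.map ρ
  -- An element of L fixed by H is fixed by U in M, so it lies in N by the Galois correspondence.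
  have hHN : ∀ x ∈ fixedField H, algebraMap L M x ∈ N := by
    intro x hx
    rw [← IsGalois.fixedField_fixingSubgroup N, mem_fixedField_iff]
    intro σ hσ
    rw [← hρ, (mem_fixedField_iff _ _).1 hx _ ⟨σ, hσ, rfl⟩]
  have hdeg : Module.finrank R (fixedField H) ≤ Module.finrank B E := by
    obtain ⟨θ, hθ⟩ := Field.exists_primitive_element R (fixedField H)
    obtain ⟨c, hc, hθc⟩ := mem_adjoin_simple_of_mem_adjoin_isAlgebraic hkE (hHN θ θ.2)
    have hint : IsIntegral R (θ : L) := IsIntegral.of_finite R _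
    refine le_of_eq_of_le ?_ (natDegree_minpoly_le_finrank_of_mem_adjoin_simple hRB hkL hkE
      hint hc.isIntegral hθc)
    rw [← (Field.primitive_element_iff_minpoly_natDegree_eq R θ).1 hθ]
    exact congrArg _ (minpoly.algebraMap_eq (algebraMap (fixedField H) L).injective θ).symm
  -- |G^n| = [L : R] = [L^H : R] · |H| ≤ [E : B] · |H|.
  obtain ⟨i, hi⟩ := Subgroup.exists_surjective_eval_of_card_le (H.map e.toMonoidHom) hn (by
    rw [Subgroup.card_map_of_injective e.injective, ← Nat.card_congr e.toEquiv,
      IsGalois.card_aut_eq_finrank, ← finrank_fixedField_eq_card, mul_comm,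
      ← Module.finrank_mul_finrank R (fixedField H) L]
    exact Nat.mul_le_mul_right _ hdeg)
  let ψ : (M ≃ₐ[E] M) →* G := (Pi.evalMonoidHom (fun _ => G) i).comp (e.toMonoidHom.comp ρ)
  have hψ : ∀ g, ∃ σ ∈ U, ψ σ = g := by
    intro g
    obtain ⟨_, ⟨_, ⟨σ, hσ, rfl⟩, rfl⟩, hg⟩ := hi g
    exact ⟨σ, hσ, hg⟩
  refine ⟨fixedField ψ.ker, inferInstance, inferInstance, ?_, ?_⟩
  · intro x hx hxk
    -- As ψ maps U onto G, Gal(M/E) = U · ker ψ. The kernel fixes `x` because it lies in the fixed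
    -- field, and U fixes it because it is algebraic over `k`.
    have hfix : ∀ σ : M ≃ₐ[E] M, σ x = x := by
      intro σ
      obtain ⟨τ, hτ, hτσ⟩ := hψ (ψ σ)
      have hker : τ⁻¹ * σ ∈ ψ.ker := by simp [MonoidHom.mem_ker, hτσ]
      have h1 : (τ⁻¹ * σ) x = x := (mem_fixedField_iff _ _).1 hx _ hker
      have h2 : τ x = x := (mem_fixingSubgroup_iff N τ).1 hτ x (subset_adjoin E _ hxk)
      calc σ x = τ ((τ⁻¹ * σ) x) := by
            rw [← AlgEquiv.mul_apply, mul_inv_cancel_left]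
        _ = x := by rw [h1, h2]
    obtain ⟨y, rfl⟩ := (IsGalois.mem_range_algebraMap_iff_fixed x).2 hfix
    obtain ⟨a, rfl⟩ := hkE y ((isAlgebraic_algebraMap_iff (algebraMap E M).injective).1 hxk)
    exact ⟨a, IsScalarTower.algebraMap_apply k E M a⟩
  · refine ⟨(IsGalois.normalAutEquivQuotient ψ.ker).symm.trans
      (QuotientGroup.quotientKerEquivOfSurjective ψ fun g => ?_)⟩
    obtain ⟨σ, -, hσ⟩ := hψ g
    exact ⟨σ, hσ⟩

/-! ### Independence of the remaining variables over k(t) and its algebraic extensions. -/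

theorem AlgebraicIndependent.polynomial_of_algebraMap_X {k Ω ι : Type*} [Field k] [Field Ω]
    [Algebra k Ω] [Algebra k[X] Ω] [IsScalarTower k k[X] Ω] {x : ι → Ω}
    (hx : AlgebraicIndependent k x) {i : ι} (hi : algebraMap k[X] Ω X = x i) :
    AlgebraicIndependent k[X] (fun j : ({i}ᶜ : Set ι) => x j) := by
  have h := hx.adjoin_of_disjoint (s := {i}) (t := {i}ᶜ) disjoint_compl_right
  let y : Algebra.adjoin k (x '' {i}) := ⟨x i, Algebra.subset_adjoin ⟨i, rfl, rfl⟩⟩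
  have hcomp : ∀ p : k[X], ((aeval y p : Algebra.adjoin k (x '' {i})) : Ω) = aeval (x i) p :=
    fun p => (aeval_algebraMap_apply Ω y p).symm
  refine AlgebraicIndependent.of_ringHom_of_comp_eq
    (aeval y : k[X] →ₐ[k] Algebra.adjoin k (x '' {i})).toRingHom (RingHom.id Ω) h ?_ ?_
  · intro p q hpq
    refine transcendental_iff_injective.1 (hx.transcendental i) ?_
    rw [← hcomp, ← hcomp]
    exact congrArg Subtype.val hpq
  · ext p
    · change ((aeval y (C p) : Algebra.adjoin k (x '' {i})) : Ω) = algebraMap k[X] Ω (C p)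
      rw [hcomp, aeval_C, IsScalarTower.algebraMap_apply k k[X] Ω]
      rfl
    · change ((aeval y X : Algebra.adjoin k (x '' {i})) : Ω) = algebraMap k[X] Ω X
      rw [hcomp, aeval_X, hi]

theorem AlgebraicIndependent.extendScalars_ratFunc {k F Ω ι : Type*} [Field k] [Field F] [Field Ω]
    [Algebra k Ω] [Algebra (RatFunc k) F] [Algebra F Ω] [Algebra (RatFunc k) Ω]
    [IsScalarTower k (RatFunc k) Ω] [IsScalarTower (RatFunc k) F Ω]
    [Algebra.IsAlgebraic (RatFunc k) F] {x : ι → Ω}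
    (hx : AlgebraicIndependent k x) {i : ι} (hi : algebraMap (RatFunc k) Ω RatFunc.X = x i) :
    AlgebraicIndependent F (fun j : ({i}ᶜ : Set ι) => x j) := by
  let _ : Algebra k[X] Ω :=
    ((algebraMap (RatFunc k) Ω).comp (algebraMap k[X] (RatFunc k))).toAlgebra
  have : IsScalarTower k[X] (RatFunc k) Ω := IsScalarTower.of_algebraMap_eq fun _ => rfl
  have : IsScalarTower k k[X] Ω := IsScalarTower.of_algebraMap_eq fun a => by
    rw [IsScalarTower.algebraMap_apply k (RatFunc k) Ω,
      IsScalarTower.algebraMap_apply k k[X] (RatFunc k)]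
    rfl
  have h1 : AlgebraicIndependent k[X] (fun j : ({i}ᶜ : Set ι) => x j) :=
    hx.polynomial_of_algebraMap_X (by rw [← hi, ← RatFunc.algebraMap_X]; rfl)
  have : Algebra.IsAlgebraic k[X] (RatFunc k) :=
    IsLocalization.isAlgebraic (RatFunc k) (nonZeroDivisors k[X])
  exact (h1.extendScalars (RatFunc k)).extendScalars F

/-! ### The tower k(t), k(S), E and the compositum with L. -/

theorem SkewExt.ClassicalRIGP.exists_isGalois {k : Type u} {E : Type v} [Field k] [Field E]
    [Algebra k E] (hk : SkewExt.ClassicalRIGP k)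
    (hkE : ∀ x : E, IsAlgebraic k x → x ∈ Set.range (algebraMap k E))
    {S : Set E} (hS : AlgebraicIndependent k ((↑) : S → E)) (t : S)
    [FiniteDimensional (adjoin k S) E] (G : Type) [Group G] [Finite G] :
    ∃ (L : Type v) (_ : Field L) (_ : Algebra E L) (_ : Algebra k L) (_ : IsScalarTower k E L),
      FiniteDimensional E L ∧ IsGalois E L ∧
      (∀ x : L, IsAlgebraic k x → x ∈ Set.range (algebraMap k L)) ∧
      Nonempty ((L ≃ₐ[E] L) ≃* G) := by
  have ht : Function.Injective (aeval (t : E) : k[X] →ₐ[k] E) :=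
    transcendental_iff_injective.1 (hS.transcendental t)
  let f : RatFunc k →ₐ[k] E := IsFractionRing.liftAlgHom (K := RatFunc k) ht
  have hf : f RatFunc.X = t := by
    rw [← RatFunc.algebraMap_X, IsFractionRing.liftAlgHom_apply, IsFractionRing.lift_algebraMap]
    simp
  let _ : Algebra (RatFunc k) E := f.toRingHom.toAlgebra
  have : IsScalarTower k (RatFunc k) E := IsScalarTower.of_algebraMap_eq fun a =>
    (f.commutes a).symm
  let x : S → E := (↑)
  let B : IntermediateField (RatFunc k) E :=
    adjoin (RatFunc k) (Set.range fun j : ({t}ᶜ : Set S) => x j)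
  have hSB : ∀ s ∈ S, s ∈ B := by
    intro s hs
    by_cases hst : (⟨s, hs⟩ : S) = t
    · have : s = algebraMap (RatFunc k) E RatFunc.X := by
        rw [show s = (t : E) from congrArg Subtype.val hst, ← hf]; rfl
      rw [this]
      exact B.algebraMap_mem _
    · exact subset_adjoin _ _ ⟨⟨⟨s, hs⟩, hst⟩, rfl⟩
  have hKB : adjoin k S ≤ B.restrictScalars k := by
    rw [adjoin_le_iff]; exact hSB
  have hBE : FiniteDimensional B E := by
    let _ : Algebra (adjoin k S) B := (inclusion hKB).toRingHom.toAlgebra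
    have : IsScalarTower (adjoin k S) B E := IsScalarTower.of_algebraMap_eq fun _ => rfl
    exact Module.Finite.of_restrictScalars_finite (adjoin k S) B E
  obtain ⟨n, hn⟩ : ∃ n, Module.finrank B E < 2 ^ n := ⟨_, Nat.lt_two_pow_self⟩
  obtain ⟨L, _, _, _, _, hGal, hcl, ⟨e⟩⟩ := hk (Fin n → G)
  have : Finite (L ≃ₐ[RatFunc k] L) := Finite.of_equiv _ e.symm.toEquiv
  have : FiniteDimensional (RatFunc k) L := IsGalois.finiteDimensional_of_finite _ _
  obtain ⟨M, _, _, _, _, _, _, ⟨φ⟩⟩ := IsGalois.exists_isGalois_algHom (E := E) (R := RatFunc k) L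
  let _ : Algebra k M := ((algebraMap E M).comp (algebraMap k E)).toAlgebra
  have : IsScalarTower k E M := IsScalarTower.of_algebraMap_eq fun _ => rfl
  have : IsScalarTower k (RatFunc k) M := IsScalarTower.of_algebraMap_eq fun a => by
    rw [IsScalarTower.algebraMap_apply (RatFunc k) E M, ← IsScalarTower.algebraMap_apply k _ E]
    rfl
  let _ : Algebra L M := φ.toRingHom.toAlgebra
  have : IsScalarTower (RatFunc k) L M := IsScalarTower.of_algebraMap_eq fun a =>
    (φ.commutes a).symm
  have : IsScalarTower k L M := IsScalarTower.of_algebraMap_eq fun a => by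
    rw [IsScalarTower.algebraMap_apply k (RatFunc k) M,
      IsScalarTower.algebraMap_apply k (RatFunc k) L,
      ← IsScalarTower.algebraMap_apply (RatFunc k) L M]
  have : IsScalarTower k B M := IsScalarTower.of_algebraMap_eq fun a => by
    rw [IsScalarTower.algebraMap_apply k E M, IsScalarTower.algebraMap_apply B E M]
    rfl
  have hRB : ∀ y : B, IsAlgebraic (RatFunc k) y → y ∈ Set.range (algebraMap (RatFunc k) B) := by
    intro y hy
    have hR : AlgebraicIndependent (RatFunc k) (fun j : ({t}ᶜ : Set S) => x j) :=
      hS.extendScalars_ratFunc hf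
    obtain ⟨a, ha⟩ := hR.mem_range_of_mem_adjoin_of_isAlgebraic y.2 (hy.algebraMap (A := E))
    exact ⟨a, Subtype.ext ha⟩
  have hxM : AlgebraicIndependent k (fun s : S => algebraMap E M (x s)) :=
    hS.map' (f := IsScalarTower.toAlgHom k E M) (algebraMap E M).injective
  have hL : AlgebraicIndependent L (fun j : ({t}ᶜ : Set S) => algebraMap E M (x j)) :=
    hxM.extendScalars_ratFunc (i := t) (by
      rw [IsScalarTower.algebraMap_apply (RatFunc k) E M]
      exact congrArg _ hf)
  -- The compositum of L and B is purely transcendental over L, so its elements algebraic over `k`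
  -- lie in L, hence in `k`.
  have hkL : ∀ y ∈ adjoin L (Set.range (algebraMap B M)), IsAlgebraic k y →
      y ∈ Set.range (algebraMap k M) := by
    intro y hy hyk
    have hle : adjoin L (Set.range (algebraMap B M)) ≤
        adjoin L (Set.range fun j : ({t}ᶜ : Set S) => algebraMap E M (x j)) := by
      rw [adjoin_le_iff]
      rintro _ ⟨b, rfl⟩
      have hB : B ≤ ((adjoin L (Set.range fun j : ({t}ᶜ : Set S) =>
          algebraMap E M (x j))).restrictScalars (RatFunc k)).comap
          (IsScalarTower.toAlgHom (RatFunc k) E M) := by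
        rw [adjoin_le_iff]
        rintro _ ⟨j, rfl⟩
        exact subset_adjoin L _ ⟨j, rfl⟩
      exact hB b.2
    obtain ⟨a, rfl⟩ := hL.mem_range_of_mem_adjoin_of_isAlgebraic (hle hy) (hyk.tower_top L)
    have ha : a ∈ algebraicClosure k L :=
      mem_algebraicClosure_iff.2 ((isAlgebraic_algebraMap_iff (algebraMap L M).injective).1 hyk)
    rw [hcl, mem_bot] at ha
    obtain ⟨b, rfl⟩ := ha
    exact ⟨b, IsScalarTower.algebraMap_apply k L M b⟩
  obtain ⟨F, hF1, hF2, hF3, hF4⟩ := exists_isGalois_of_finrank_lt (L := L) hRB hkL hkE hn e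
  have : IsScalarTower k F M := IsScalarTower.of_algebraMap_eq fun _ => rfl
  refine ⟨F, inferInstance, inferInstance, inferInstance,
    IsScalarTower.of_algebraMap_eq fun _ => rfl, hF2, hF1, ?_, hF4⟩
  intro y hy
  obtain ⟨a, ha⟩ := hF3 y y.2 (hy.algebraMap (A := M))
  exact ⟨a, Subtype.ext ha⟩

end

/-! ### The skew notions for commutative fields, and outer extensions. -/

namespace SkewExt

section Comm

variable {k : Type u} {h : Type v} [Field k] [Field h] [Algebra k h]

theorem leftFinite_toAdjoinElem_iff (x : h) :
    LeftFinite (toAdjoinElem (algebraMap k h) x) ↔ IsAlgebraic k x := by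
  have : LeftFinite (toAdjoinElem (algebraMap k h) x) ↔
      Module.Finite k (IntermediateField.adjoin k {x}) := by
    let _ : Module k (adjoinElem (algebraMap k h) x) :=
      (toAdjoinElem (algebraMap k h) x).toModule
    let e : adjoinElem (algebraMap k h) x ≃ₗ[k] IntermediateField.adjoin k {x} :=
      { toFun := fun y => ⟨y.1, y.2⟩
        invFun := fun y => ⟨y.1, y.2⟩
        map_add' := fun _ _ => rfl
        map_smul' := fun c y => Subtype.ext (Algebra.smul_def c (y : h)).symm
        left_inv := fun _ => rfl
        right_inv := fun _ => rfl }
    exact Module.Finite.equiv_iff e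
  rw [this, isAlgebraic_iff_isIntegral]
  refine ⟨fun hfin => ?_, fun hx => IntermediateField.adjoin.finiteDimensional hx⟩
  exact (IsIntegral.of_finite k (IntermediateField.AdjoinSimple.gen k x)).map
    (IntermediateField.adjoin k {x}).val

theorem LeftFinite.rightFinite {k : Type u} {h : Type v} [Field k] [Field h] {f : k →+* h}
    (hf : LeftFinite f) : RightFinite f := by
  let _ := f.toModule
  let _ : Module kᵐᵒᵖ h := Module.compHom h f.op
  have hk : Module.Finite k h := hf
  obtain ⟨s, hs⟩ := hk.1
  refine ⟨⟨s, eq_top_iff.2 fun x _ => ?_⟩⟩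
  have hx : x ∈ Submodule.span k (s : Set h) := hs ▸ Submodule.mem_top
  induction hx using Submodule.span_induction with
  | mem x hx => exact Submodule.subset_span hx
  | zero => exact zero_mem _
  | add x y _ _ hx hy => exact add_mem (hx trivial) (hy trivial)
  | smul c x _ hx =>
    have : c • x = MulOpposite.op c • x := mul_comm (f c) x
    rw [this]
    exact Submodule.smul_mem _ _ (hx trivial)

theorem isAlgebraicElem_iff (x : h) :
    IsAlgebraicElem (algebraMap k h) x ↔ IsAlgebraic k x :=
  ⟨fun hx => (leftFinite_toAdjoinElem_iff x).1 hx.1, fun hx =>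
    have hl := (leftFinite_toAdjoinElem_iff x).2 hx
    ⟨hl, hl.rightFinite⟩⟩

theorem isRegularExt_iff : IsRegularExt (algebraMap k h) ↔
    ∀ x : h, IsAlgebraic k x → x ∈ Set.range (algebraMap k h) :=
  forall_congr' fun x => by rw [isAlgebraicElem_iff]

theorem isRegularExt_iff_algebraicClosure :
    IsRegularExt (algebraMap k h) ↔ algebraicClosure k h = ⊥ := by
  rw [isRegularExt_iff, eq_bot_iff]
  simp only [SetLike.le_def, mem_algebraicClosure_iff, IntermediateField.mem_bot]

/-- `Gal(h/k)` is the group of `k`-algebra automorphisms of `h`. -/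
def galEquiv (k : Type u) (h : Type v) [Field k] [Field h] [Algebra k h] :
    Gal (algebraMap k h) ≃* (h ≃ₐ[k] h) where
  toFun σ := AlgEquiv.ofRingEquiv (f := σ.1) fun c =>
    (mem_fixingSubgroup_iff _).1 σ.2 _ ⟨c, rfl⟩
  invFun σ := ⟨σ.toRingEquiv, (mem_fixingSubgroup_iff _).2 (by
    rintro _ ⟨c, rfl⟩
    exact σ.commutes c)⟩
  left_inv _ := rfl
  right_inv _ := rfl
  map_mul' _ _ := rfl

theorem isGaloisExt_iff_fixed : IsGaloisExt (algebraMap k h) ↔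
    ∀ x : h, (∀ σ : h ≃ₐ[k] h, σ x = x) → x ∈ Set.range (algebraMap k h) := by
  refine forall_congr' fun x => imp_congr_left ⟨fun H σ => ?_, fun H σ hσ => ?_⟩
  · exact H _ ((galEquiv k h).symm σ).2
  · exact H (galEquiv k h ⟨σ, hσ⟩)

theorem isGaloisExt_of_isGalois [IsGalois k h] : IsGaloisExt (algebraMap k h) :=
  isGaloisExt_iff_fixed.2 fun x hx => (InfiniteGalois.mem_range_algebraMap_iff_fixed x).2 hx

theorem IsGaloisExt.isGalois [Finite (h ≃ₐ[k] h)] (H : IsGaloisExt (algebraMap k h)) :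
    IsGalois k h := by
  -- Artin's theorem then applies to the finite automorphism group.
  have hbot : FixedPoints.intermediateField (F := k) (E := h) (h ≃ₐ[k] h) = ⊥ := by
    rw [eq_bot_iff]
    exact fun x hx => isGaloisExt_iff_fixed.1 H x hx
  have : IsGalois (FixedPoints.intermediateField (F := k) (E := h) (h ≃ₐ[k] h)) h :=
    IsGalois.of_fixed_field h (h ≃ₐ[k] h)
  rw [hbot] at this
  exact isGalois_iff_isGalois_bot.1 this

end Comm

theorem isOuterExt_of_comm {k : Type u} {h : Type v} [DivisionRing k] [Field h] (f : k →+* h) : IsOuterExt f := fun a _ x => by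
  rw [mul_comm (a : h) x, mul_assoc, Units.mul_inv, mul_one]

/-- By outerness, an element commuting with K is central. Apply this to elements of K, then to an
arbitrary `x`, which now commutes with K. -/
theorem IsOuterExt.mul_comm {K : Type u} {L : Type v} [Field K] [DivisionRing L] {g : K →+* L}
    (hg : IsOuterExt g) (x y : L) : x * y = y * x := by
  have key : ∀ a : L, (∀ c, a * g c = g c * a) → ∀ z, a * z = z * a := by
    intro a ha z
    by_cases h0 : a = 0
    · simp [h0]
    · have := hg (Units.mk0 a h0) (fun c => by
        rw [Units.mul_inv_eq_iff_eq_mul]; exact ha c) z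
      rwa [Units.mul_inv_eq_iff_eq_mul] at this
  have hK : ∀ c z, g c * z = z * g c := fun c =>
    key (g c) fun d => by rw [← map_mul, ← map_mul, _root_.mul_comm]
  exact key x (fun c => (hK c x).symm) y

theorem rigpExt_ratFunc_iff (k : Type u) [Field k] :
    RIGPExt (algebraMap k (RatFunc k)) ↔ ClassicalRIGP k := by
  constructor
  · intro H G _ _
    obtain ⟨L, _, g, hout, hgal, hreg, ⟨e⟩⟩ := H G
    let _ : Field L := { ‹DivisionRing L› with mul_comm := hout.mul_comm }
    let _ : Algebra (RatFunc k) L := g.toAlgebra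
    let _ : Algebra k L := (g.comp (algebraMap k (RatFunc k))).toAlgebra
    have hst : IsScalarTower k (RatFunc k) L := IsScalarTower.of_algebraMap_eq fun _ => rfl
    let e' := (galEquiv (RatFunc k) L).symm.trans e
    have : Finite (L ≃ₐ[RatFunc k] L) := Finite.of_equiv _ e'.symm.toEquiv
    exact ⟨L, inferInstance, inferInstance, inferInstance, hst,
      IsGaloisExt.isGalois (k := RatFunc k) (h := L) hgal,
      (isRegularExt_iff_algebraicClosure (k := k) (h := L)).1 hreg, ⟨e'⟩⟩
  · intro H G _ _
    obtain ⟨L, _, _, _, hst, hgal, hreg, ⟨e⟩⟩ := H G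
    refine ⟨L, inferInstance, algebraMap (RatFunc k) L, isOuterExt_of_comm _,
      isGaloisExt_of_isGalois, ?_, ⟨(galEquiv (RatFunc k) L).trans e⟩⟩
    rw [← IsScalarTower.algebraMap_eq]
    exact isRegularExt_iff_algebraicClosure.2 hreg

end SkewExt

/-! ### Conclusion. -/

theorem SkewExt.ClassicalRIGP.rigpExt {k : Type u} {E : Type v} [Field k] [Field E] [Algebra k E]
    (hk : ClassicalRIGP k) (hreg : IsRegularExt (algebraMap k E))
    (hne : ¬ Function.Surjective (algebraMap k E)) {K : IntermediateField k E}
    (hK : IsPurelyTranscendental K) [FiniteDimensional K E] :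
    RIGPExt (algebraMap k E) := by
  have hkE := isRegularExt_iff.1 hreg
  obtain ⟨S, hS, rfl⟩ := hK
  -- With `S` empty, E would be algebraic over `k`, hence equal to `k` by regularity.
  obtain ⟨t, ht⟩ : S.Nonempty := by
    by_contra hempty
    rw [Set.not_nonempty_iff_eq_empty] at hempty
    refine hne fun x => hkE x ?_
    have hx : IsIntegral (IntermediateField.adjoin k S) x := IsIntegral.of_finite _ x
    have hbot : IntermediateField.adjoin k S = ⊥ := by rw [hempty, IntermediateField.adjoin_empty]
    have : Algebra.IsIntegral k (IntermediateField.adjoin k S) := by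
      rw [hbot]; infer_instance
    exact (isIntegral_trans (R := k) x hx).isAlgebraic
  intro G _ _
  obtain ⟨L, _, _, _, hst, _, _, hL, ⟨e⟩⟩ := hk.exists_isGalois hkE hS ⟨t, ht⟩ G
  refine ⟨L, inferInstance, algebraMap E L, isOuterExt_of_comm _, isGaloisExt_of_isGalois, ?_,
    ⟨(galEquiv E L).trans e⟩⟩
  rw [← IsScalarTower.algebraMap_eq]
  exact isRegularExt_iff.2 hL

theorem proposition3 (k : Type u) [Field k] :
    ((SkewExt.RIGPExt (algebraMap k (RatFunc k)) ↔ SkewExt.ClassicalRIGP k) ∧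
      ∀ (L : Type w) [DivisionRing L] (g : RatFunc k →+* L),
        SkewExt.IsOuterExt g → SkewExt.IsGaloisExt g → Finite (SkewExt.Gal g) →
          ∀ x y : L, x * y = y * x) ∧
    (SkewExt.ClassicalRIGP k →
      ∀ (E : Type v) [Field E] [Algebra k E],
        SkewExt.IsRegularExt (algebraMap k E) →
        ¬ Function.Surjective (algebraMap k E) →
        (∃ K : IntermediateField k E, SkewExt.IsPurelyTranscendental K ∧
          FiniteDimensional K E ∧ ∃ α : E, IntermediateField.adjoin K {α} = ⊤) →
        SkewExt.InvReg (algebraMap k E)) := by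
  refine ⟨⟨SkewExt.rigpExt_ratFunc_iff k, fun L _ g hout _ _ => hout.mul_comm⟩, ?_⟩
  rintro hk E _ _ hreg hne ⟨K, hK, hfin, -⟩
  exact ⟨hreg, hk.rigpExt hreg hne hK⟩
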